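/- Let $\mathbf F\in\{\mathbb R,\mathbb C\}$. A Fréchet space is a locally convex space over $\mathbf F$ whose topology is induced by a complete translation-invariant metric. Let $E_0\hookrightarrow E_1\hookrightarrow E_2\hookrightarrow\cdots$ be a sequence of Fréchet spaces over $\mathbf F$ in which every map $E_n\hookrightarrow E_{n+1}$ is linear and a topological embedding, and let $E=\varinjlim E_n$ be its direct limit in the category of locally convex spaces and continuous linear maps, i.e. the vector space $\bigcup_n E_n$ with the finest locally convex topology for which all the inclusions $E_n\to E$ are continuous (such an $E$ is called a strict $(LF)$-space). Then the following are equivalent: 1. $E$ is $\kappa$-Fréchet–Urysohn, i.e. for every open set $U\subseteq E$ and every $x\in\overline U$ there is a sequence of points of $U$ that converges to $x$; 2. $E$ is a Fréchet space. -/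

import Mathlib

open Filter Topology

/-- `X` is κ-Fréchet–Urysohn: every point of the closure of an open set `U` is the limit of a
sequence of points of `U`. -/
def IsKappaFrechetUrysohn (X : Type*) [TopologicalSpace X] : Prop :=
  ∀ U : Set X, IsOpen U → ∀ x ∈ closure U,
    ∃ s : ℕ → X, (∀ n, s n ∈ U) ∧ Tendsto s atTop (𝓝 x)

/-- `E` is a Fréchet space over `𝕜`: a locally convex space (its topology is a vector space
topology given by seminorms, `PolynormableSpace`) whose topology is induced by a complete
translation invariant metric. -/
structure IsFrechetSpace (𝕜 E : Type*) [RCLike 𝕜] [AddCommGroup E] [Module 𝕜 E]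
    [t : TopologicalSpace E] : Prop where
  locallyConvex : PolynormableSpace 𝕜 E
  exists_metric : ∃ m : MetricSpace E,
    m.toUniformSpace.toTopologicalSpace = t ∧
    (∀ x y z : E, m.dist (x + z) (y + z) = m.dist x y) ∧
    @CompleteSpace E m.toUniformSpace

/-- `E` is the strict (LF)-space given by the sequence `X 0 → X 1 → X 2 → ⋯` of Fréchet spaces:
the linear maps `i n : X n → X (n + 1)` are topological embeddings (strictness), and `E`, with
the maps `ι n : X n → E`, is the direct limit of the sequence in the category of locally convex
spaces. That is, `E` is the direct limit of the sequence of vector spaces (the `ι n` are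
injective, compatible with the `i n`, and their ranges cover `E`), and its topology is the finest
locally convex topology for which all the `ι n` are continuous. Note that `t ≤ s` means that `t`
is finer than `s`. -/
structure IsStrictLFSpace {𝕜 E : Type*} [RCLike 𝕜] [AddCommGroup E] [Module 𝕜 E]
    [t : TopologicalSpace E] {X : ℕ → Type*} [∀ n, AddCommGroup (X n)] [∀ n, Module 𝕜 (X n)]
    [∀ n, TopologicalSpace (X n)]
    (i : ∀ n, X n →L[𝕜] X (n + 1)) (ι : ∀ n, X n →L[𝕜] E) : Prop where
  isFrechetSpace : ∀ n, IsFrechetSpace 𝕜 (X n)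
  isEmbedding : ∀ n, IsEmbedding (i n)
  compatible : ∀ n (x : X n), ι (n + 1) (i n x) = ι n x
  injective : ∀ n, Function.Injective (ι n)
  exhaustive : ∀ y : E, ∃ n, ∃ x : X n, ι n x = y
  locallyConvex : PolynormableSpace 𝕜 E
  finest : ∀ s : TopologicalSpace E, PolynormableSpace 𝕜 E (topology := s) →
    (∀ n, Continuous[_, s] (ι n)) → t ≤ s

/-! A Fréchet space is first countable, which gives one direction. Conversely, suppose no step is
all of `E`. Steps are closed with dense complement, so for a nonzero continuous seminorm `p` the
open set `U = ⋃ k, {p > 1/(k+1)} \ range (ι k)` has `0` in its closure. A sequence in `U` tending to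
`0` would lie in one step `m`, which forces `p > 1/(m+1)` along it: a contradiction. So some `ι n`
is onto, and it is a homeomorphism. Closed steps, confinement of null sequences and the
homeomorphism all rest on `exists_seminorm_extension`, which extends a seminorm step by step. -/

section SeminormExtension

variable {𝕜 X Y : Type*} [RCLike 𝕜] [AddCommGroup X] [Module 𝕜 X] [AddCommGroup Y] [Module 𝕜 Y]

/-- A seminorm `p` on `X` dominated by the restriction of a seminorm `r` on `Y` along `f : X → Y`
extends to the infimal convolution `y ↦ ⨅ x, p x + r (y - f x)`, a seminorm on `Y` that lies below
`r` and above the distance to the range of `f`. -/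
theorem Seminorm.exists_comp_eq_of_le_comp (f : X →ₗ[𝕜] Y) (p : Seminorm 𝕜 X) (r : Seminorm 𝕜 Y)
    (h : p ≤ r.comp f) :
    ∃ q : Seminorm 𝕜 Y, q.comp f = p ∧ q ≤ r ∧
      ∀ (y : Y) (c : ℝ), (∀ x, c ≤ r (y - f x)) → c ≤ q y := by
  have bdd (y : Y) : BddBelow (Set.range fun x => p x + r (y - f x)) :=
    ⟨0, by rintro _ ⟨x, rfl⟩; dsimp; positivity⟩
  have le_r (y : Y) : ⨅ x, p x + r (y - f x) ≤ r y :=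
    ciInf_le_of_le (bdd y) 0 (by simp)
  refine ⟨Seminorm.ofSMulLE (fun y => ⨅ x, p x + r (y - f x)) ?_ ?_ ?_, ?_, le_r, ?_⟩
  · exact le_antisymm ((le_r 0).trans_eq (map_zero r)) (le_ciInf fun x => by positivity)
  · intro y z
    refine le_ciInf_add_ciInf fun u v => ciInf_le_of_le (bdd _) (u + v) ?_
    have h₁ := map_add_le_add p u v
    have h₂ := map_add_le_add r (y - f u) (z - f v)
    rw [sub_add_sub_comm, ← map_add] at h₂
    linarith
  · intro a y
    rw [Real.mul_iInf_of_nonneg (norm_nonneg a)]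
    refine le_ciInf fun x => ciInf_le_of_le (bdd _) (a • x) ?_
    rw [f.map_smul, ← smul_sub, map_smul_eq_mul, map_smul_eq_mul, mul_add]
  · ext x
    refine le_antisymm (ciInf_le_of_le (bdd _) x (by simp)) (le_ciInf fun u => ?_)
    have h₁ : p (x - u) ≤ r (f (x - u)) := h (x - u)
    have h₂ := map_add_le_add p u (x - u)
    rw [add_sub_cancel] at h₂
    rw [f.map_sub] at h₁
    change p x ≤ p u + r (f x - f u)
    linarith
  · intro y c hc
    exact le_ciInf fun x => (hc x).trans (le_add_of_nonneg_left (apply_nonneg p x))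

/-- A continuous seminorm extends along a closed embedding, and the extension can be required to be
at least `1` at a given point off the range. -/
theorem Seminorm.exists_continuous_comp_eq [TopologicalSpace X] [TopologicalSpace Y]
    [PolynormableSpace 𝕜 Y] (f : X →L[𝕜] Y) (hf : IsClosedEmbedding f) {p : Seminorm 𝕜 X}
    (hp : Continuous p) (y : Y) :
    ∃ q : Seminorm 𝕜 Y, Continuous q ∧ q.comp (f : X →ₗ[𝕜] Y) = p ∧
      (y ∉ Set.range f → 1 ≤ q y) := by
  have hY := PolynormableSpace.withSeminorms 𝕜 Y
  have := hY.topologicalAddGroup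
  obtain ⟨r, hr, hpr⟩ := Seminorm.exists_le_comp_of_isInducing (f := (f : X →ₗ[𝕜] Y)) hp
    hf.isInducing
  by_cases hy : y ∈ Set.range f
  · obtain ⟨q, hq, hqr, -⟩ := Seminorm.exists_comp_eq_of_le_comp _ p r hpr
    exact ⟨q, Seminorm.continuous_of_le hr hqr, hq, fun h => absurd hy h⟩
  obtain ⟨s, ε, hε, hs⟩ := (hY.mem_nhds_iff y _).1 (hf.isClosed_range.isOpen_compl.mem_nhds hy)
  set g : Seminorm 𝕜 Y := s.sup fun p : {p : Seminorm 𝕜 Y // Continuous p} => p.1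
  have hg : Continuous g := Seminorm.continuous_finsetSup fun i _ => i.2
  -- The `g`-ball of radius `ε` at `y` misses the range, so the scaled `g` is at least `1` on `y - f
  -- x`.
  set r' : Seminorm 𝕜 Y := r + ε⁻¹.toNNReal • g
  have hr'_apply (z : Y) : r' z = r z + ε⁻¹ * g z := by
    simp [r', NNReal.smul_def, hε.le]
  have hr' : Continuous r' := by
    have : (r' : Y → ℝ) = fun z => r z + ε⁻¹ * g z := funext hr'_apply
    rw [this]
    fun_prop
  have hpr' : p ≤ r'.comp (f : X →ₗ[𝕜] Y) := fun x => by
    rw [Seminorm.comp_apply, hr'_apply]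
    exact (hpr x).trans (le_add_of_nonneg_right (by positivity))
  obtain ⟨q, hq, hqr, hle⟩ := Seminorm.exists_comp_eq_of_le_comp _ p r' hpr'
  refine ⟨q, Seminorm.continuous_of_le hr' hqr, hq, fun _ => hle y 1 fun x => ?_⟩
  have hx : ε ≤ g (y - f x) := by
    by_contra! h
    refine hs (show f x ∈ g.ball y ε from ?_) (Set.mem_range_self x)
    rwa [Seminorm.mem_ball, map_sub_rev]
  rw [ContinuousLinearMap.coe_coe, hr'_apply]
  have h₁ : 1 ≤ ε⁻¹ * g (y - f x) := by
    rw [← div_eq_inv_mul]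
    exact (one_le_div hε).2 hx
  linarith [apply_nonneg r (y - f x)]

end SeminormExtension

/-! ### Fréchet spaces -/

namespace IsFrechetSpace

variable {𝕜 X Y : Type*} [RCLike 𝕜] [AddCommGroup X] [Module 𝕜 X] [AddCommGroup Y] [Module 𝕜 Y]

theorem firstCountableTopology [TopologicalSpace X] (hX : IsFrechetSpace 𝕜 X) :
    FirstCountableTopology X := by
  obtain ⟨m, rfl, -, -⟩ := hX.exists_metric
  infer_instance

theorem t2Space [TopologicalSpace X] (hX : IsFrechetSpace 𝕜 X) : T2Space X := by
  obtain ⟨m, rfl, -, -⟩ := hX.exists_metric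
  infer_instance

/-- An embedding of topological groups is uniform, so the range is complete, hence closed. -/
theorem isClosedEmbedding [t : TopologicalSpace X] [TopologicalSpace Y] (hX : IsFrechetSpace 𝕜 X)
    [IsTopologicalAddGroup Y] [T2Space Y] {f : X →L[𝕜] Y} (hf : IsEmbedding f) :
    IsClosedEmbedding f := by
  obtain ⟨m, rfl, hm, hc⟩ := hX.exists_metric
  let : NormedAddCommGroup X :=
    let : Norm X := ⟨fun x => dist x 0⟩
    NormedAddCommGroup.ofAddDist' (fun x => dist_comm x 0) fun x y z => by
      simpa only [add_comm z] using (hm x y z).le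
  let := IsTopologicalAddGroup.rightUniformSpace Y
  have := isUniformAddGroup_of_addCommGroup (G := Y)
  exact ⟨hf, ((AddMonoidHom.isUniformInducing_of_isInducing
    hf.isInducing).isComplete_range).isClosed⟩

theorem of_continuousLinearEquiv [TopologicalSpace X] [t : TopologicalSpace Y]
    (hX : IsFrechetSpace 𝕜 X) (e : Y ≃L[𝕜] X) : IsFrechetSpace 𝕜 Y where
  locallyConvex :=
    have := hX.locallyConvex
    e.toHomeomorph.isInducing.polynormableSpace (f := (e : Y →ₗ[𝕜] X))
  exists_metric := by
    have he : t = TopologicalSpace.induced e inferInstance := e.toHomeomorph.isInducing.eq_induced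
    obtain ⟨m, rfl, hm, hc⟩ := hX.exists_metric
    refine ⟨MetricSpace.induced e e.injective m, he.symm, fun x y z => ?_, ?_⟩
    · change dist (e (x + z)) (e (y + z)) = dist (e x) (e y)
      rw [map_add, map_add]
      exact hm _ _ _
    · let := MetricSpace.induced e e.injective m
      have hi : IsUniformInducing e := ⟨rfl⟩
      exact (completeSpace_congr (e := e.toEquiv) ⟨hi, e.injective⟩).2 hc

end IsFrechetSpace

/-! ### Seminorms on strict (LF)-spaces -/

namespace IsStrictLFSpace

variable {𝕜 E : Type*} [RCLike 𝕜] [AddCommGroup E] [Module 𝕜 E] [t : TopologicalSpace E]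
  {X : ℕ → Type*} [∀ n, AddCommGroup (X n)] [∀ n, Module 𝕜 (X n)] [∀ n, TopologicalSpace (X n)]
  {i : ∀ n, X n →L[𝕜] X (n + 1)} {ι : ∀ n, X n →L[𝕜] E}

theorem isClosedEmbedding (hE : IsStrictLFSpace i ι) (n : ℕ) : IsClosedEmbedding (i n) := by
  have := (hE.isFrechetSpace (n + 1)).locallyConvex
  have := (PolynormableSpace.withSeminorms 𝕜 (X (n + 1))).topologicalAddGroup
  have := (hE.isFrechetSpace (n + 1)).t2Space
  exact (hE.isFrechetSpace n).isClosedEmbedding (hE.isEmbedding n)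

theorem range_mono (hE : IsStrictLFSpace i ι) : Monotone fun n => Set.range (ι n) :=
  monotone_nat_of_le_succ fun n => by
    rintro _ ⟨x, rfl⟩
    exact ⟨i n x, hE.compatible n x⟩

/-- Each map factors through the next, so continuity descends from late steps to early ones. -/
theorem continuous_of_continuous_add {Z : Type*} [TopologicalSpace Z] {g : ∀ m, X m → Z}
    (hg : ∀ m, g (m + 1) ∘ i m = g m) {n : ℕ} (h : ∀ k, Continuous (g (n + k))) {d : ℕ} (m : ℕ)
    (hm : n ≤ m + d) : Continuous (g m) := by
  induction d generalizing m with
  | zero =>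
    obtain ⟨k, rfl⟩ := Nat.exists_eq_add_of_le hm
    exact h k
  | succ d ih => exact hg m ▸ (ih (m + 1) (by omega)).comp (i m).continuous

theorem shift (hE : IsStrictLFSpace i ι) (n : ℕ) :
    IsStrictLFSpace (X := fun k => X (n + k)) (fun k => i (n + k)) (fun k => ι (n + k)) where
  isFrechetSpace k := hE.isFrechetSpace _
  isEmbedding k := hE.isEmbedding _
  compatible k := hE.compatible _
  injective k := hE.injective _
  exhaustive y := by
    obtain ⟨m, hm⟩ := hE.exhaustive y
    exact ⟨m, hE.range_mono (Nat.le_add_left m n) hm⟩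
  locallyConvex := hE.locallyConvex
  finest := by
    let g (m : ℕ) : X m → E := ι m
    have hg (m : ℕ) : g (m + 1) ∘ i m = g m := funext (hE.compatible m)
    have hfin := hE.finest
    exact fun s hs h => hfin s hs fun m =>
      continuous_of_continuous_add (g := g) hg h m (Nat.le_add_left n m)

/-- Seminorms on `E` are continuous when all their restrictions to the steps are. -/
theorem continuous_seminorm (hE : IsStrictLFSpace i ι) (q : Seminorm 𝕜 E)
    (hq : ∀ n, Continuous fun x => q (ι n x)) : Continuous q := by
  let F : SeminormFamily 𝕜 E Unit := fun _ => q
  have hfin := hE.finest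
  have hX (n : ℕ) := (hE.isFrechetSpace n).locallyConvex
  let L (n : ℕ) : X n →ₗ[𝕜] E := ι n
  -- The topology defined by `q` alone competes in `finest`.
  let s : TopologicalSpace E := F.moduleFilterBasis.topology
  have hF : WithSeminorms (topology := s) F := @WithSeminorms.mk _ _ _ _ _ _ F s rfl
  refine continuous_le_dom (hfin s (@WithSeminorms.toPolynormableSpace _ _ _ _ _ _ s F hF)
    fun n => ?_) (@WithSeminorms.continuous_seminorm _ _ _ _ _ _ s F hF ())
  have := hX n
  have := (PolynormableSpace.withSeminorms 𝕜 (X n)).topologicalAddGroup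
  exact @WithSeminorms.continuous_of_continuous_comp _ _ _ _ _ _ _ _ _ _ _ _ _ F _ _ s hF
    (L n) fun _ => hq n

theorem exists_seminorm_comp_eq_of_compatible (hE : IsStrictLFSpace i ι)
    (Q : ∀ n, Seminorm 𝕜 (X n)) (hQ : ∀ n, Continuous (Q n))
    (hi : ∀ n x, Q (n + 1) (i n x) = Q n x) :
    ∃ q : Seminorm 𝕜 E, Continuous q ∧ ∀ n x, q (ι n x) = Q n x := by
  have up : ∀ (k l : ℕ), k ≤ l → ∀ x : X k, ∃ x' : X l, ι l x' = ι k x ∧ Q l x' = Q k x := by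
    intro k l hkl x
    induction l, hkl using Nat.le_induction with
    | base => exact ⟨x, rfl, rfl⟩
    | succ l _ ih =>
      obtain ⟨x', h₁, h₂⟩ := ih
      exact ⟨i l x', (hE.compatible l x').trans h₁, (hi l x').trans h₂⟩
  have well_defined : ∀ (k l : ℕ) (x : X k) (y : X l), ι k x = ι l y → Q k x = Q l y := by
    intro k l x y h
    obtain ⟨x', hx', hx⟩ := up k (max k l) (le_max_left _ _) x
    obtain ⟨y', hy', hy⟩ := up l (max k l) (le_max_right _ _) y
    rw [← hx, ← hy, hE.injective _ (hx'.trans (h.trans hy'.symm))]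
  choose N v hv using hE.exhaustive
  have apply_eq (n : ℕ) (x : X n) : Q (N (ι n x)) (v (ι n x)) = Q n x := well_defined _ _ _ _ (hv _)
  let q : Seminorm 𝕜 E := Seminorm.ofSMulLE (fun y => Q (N y) (v y))
    (by
      have h := apply_eq 0 0
      rwa [map_zero (ι 0), map_zero (Q 0)] at h)
    (fun y z => by
      obtain ⟨y', hy', hy⟩ := up (N y) (max (N y) (N z)) (le_max_left _ _) (v y)
      obtain ⟨z', hz', hz⟩ := up (N z) (max (N y) (N z)) (le_max_right _ _) (v z)
      have h : y + z = ι _ (y' + z') := by rw [map_add, hy', hz', hv, hv]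
      rw [← hy, ← hz, h, apply_eq]
      exact map_add_le_add _ _ _)
    (fun a y => by
      have h : a • y = ι _ (a • v y) := by rw [map_smul, hv]
      rw [h, apply_eq, map_smul_eq_mul])
  exact ⟨q, hE.continuous_seminorm q fun n => (hQ n).congr fun x => (apply_eq n x).symm, apply_eq⟩

/-- A continuous seminorm on the first step extends to a continuous seminorm on `E` that is at
least `1` at prescribed points `w n`, one in each difference of consecutive steps. -/
theorem exists_seminorm_extension (hE : IsStrictLFSpace i ι) {p : Seminorm 𝕜 (X 0)}
    (hp : Continuous p) (w : ∀ n, X (n + 1)) :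
    ∃ q : Seminorm 𝕜 E, Continuous q ∧ (∀ x, q (ι 0 x) = p x) ∧
      ∀ n, w n ∉ Set.range (i n) → 1 ≤ q (ι (n + 1) (w n)) := by
  have step (n : ℕ) (Q : {Q : Seminorm 𝕜 (X n) // Continuous Q}) :
      ∃ Q' : {Q : Seminorm 𝕜 (X (n + 1)) // Continuous Q},
        Q'.1.comp (i n : X n →ₗ[𝕜] X (n + 1)) = Q.1 ∧
        (w n ∉ Set.range (i n) → 1 ≤ Q'.1 (w n)) := by
    have := (hE.isFrechetSpace (n + 1)).locallyConvex
    obtain ⟨q, hq, h⟩ := Seminorm.exists_continuous_comp_eq (i n) (hE.isClosedEmbedding n) Q.2 (w n)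
    exact ⟨⟨q, hq⟩, h⟩
  choose next hnext_comp hnext_le using step
  let Q (n : ℕ) : {Q : Seminorm 𝕜 (X n) // Continuous Q} := Nat.rec ⟨p, hp⟩ next n
  obtain ⟨q, hq, hqQ⟩ := hE.exists_seminorm_comp_eq_of_compatible (fun n => (Q n).1)
    (fun n => (Q n).2) fun n x => DFunLike.congr_fun (hnext_comp n (Q n)) x
  refine ⟨q, hq, hqQ 0, fun n hn => ?_⟩
  rw [hqQ]
  exact hnext_le n (Q n) hn

theorem exists_mem_range_succ_notMem_range (hE : IsStrictLFSpace i ι) {y : E} {m : ℕ}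
    (hy : y ∉ Set.range (ι m)) :
    ∃ n, m ≤ n ∧ y ∉ Set.range (ι n) ∧ y ∈ Set.range (ι (n + 1)) := by
  classical
  have hex : ∃ n, y ∈ Set.range (ι n) := hE.exhaustive y
  have hlt : m < Nat.find hex := by
    by_contra! h
    exact hy (hE.range_mono h (Nat.find_spec hex))
  refine ⟨Nat.find hex - 1, by omega, Nat.find_min hex (by omega), ?_⟩
  rw [Nat.sub_add_cancel (by omega)]
  exact Nat.find_spec hex

theorem notMem_range_of_notMem_range (hE : IsStrictLFSpace i ι) {n : ℕ} {x : X (n + 1)}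
    (hx : ι (n + 1) x ∉ Set.range (ι n)) : x ∉ Set.range (i n) := by
  rintro ⟨z, rfl⟩
  exact hx ⟨z, (hE.compatible n z).symm⟩

theorem exists_seminorm_eq_zero_one_le (hE : IsStrictLFSpace i ι) {y : E}
    (hy : y ∉ Set.range (ι 0)) :
    ∃ q : Seminorm 𝕜 E, Continuous q ∧ (∀ x, q (ι 0 x) = 0) ∧ 1 ≤ q y := by
  obtain ⟨n, -, hn, x, rfl⟩ := hE.exists_mem_range_succ_notMem_range hy
  obtain ⟨q, hq, h₀, h₁⟩ := hE.exists_seminorm_extension (p := 0) continuous_const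
    -- The filler `0` lies in every range, so it imposes no condition.
    (Function.update 0 n x)
  refine ⟨q, hq, h₀, ?_⟩
  simpa using h₁ n (by simpa using hE.notMem_range_of_notMem_range hn)

/-- After shifting, step `n` is the initial one, and continuous seminorms vanishing on it separate
it from outside points. -/
theorem isClosed_range (hE : IsStrictLFSpace i ι) (n : ℕ) : IsClosed (Set.range (ι n)) := by
  refine isClosed_of_closure_subset fun y hy => ?_
  by_contra hn
  obtain ⟨q, hq, h₀, h₁⟩ := (hE.shift n).exists_seminorm_eq_zero_one_le hn
  have hz : closure (Set.range (ι n)) ⊆ {z | q z = 0} :=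
    closure_minimal (by rintro _ ⟨x, rfl⟩; exact h₀ x) (isClosed_eq hq continuous_const)
  have : q y = 0 := hz hy
  linarith

/-- A sequence that converges to `0` lies in one step. -/
theorem exists_forall_mem_range_of_tendsto_zero (hE : IsStrictLFSpace i ι) {s : ℕ → E}
    (hs : Tendsto s atTop (𝓝 0)) : ∃ m, ∀ j, s j ∈ Set.range (ι m) := by
  classical
  by_contra! hcon
  have hw (n : ℕ) : ∃ w : X (n + 1), (∃ j, s j ∉ Set.range (ι n) ∧ s j ∈ Set.range (ι (n + 1))) →
      ∃ j, s j ∉ Set.range (ι n) ∧ ι (n + 1) w = s j := by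
    by_cases h : ∃ j, s j ∉ Set.range (ι n) ∧ s j ∈ Set.range (ι (n + 1))
    · obtain ⟨j, hj, x, hx⟩ := h
      exact ⟨x, fun _ => ⟨j, hj, hx⟩⟩
    · exact ⟨0, fun h' => absurd h' h⟩
  choose w hw using hw
  obtain ⟨q, hq, -, hle⟩ := hE.exists_seminorm_extension (p := 0) continuous_const w
  have hlt : ∀ᶠ j in atTop, q (s j) < 1 :=
    ((hq.tendsto' 0 0 (map_zero q)).comp hs).eventually_lt_const one_pos
  obtain ⟨M, hM⟩ := eventually_atTop.1 hlt
  choose N hN using fun j => hE.exhaustive (s j)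
  -- Step `m` contains the first `M` terms, so the term `s k` selected by `w`, possibly not `s j`,
  -- has `k ≥ M`.
  let m := (Finset.range M).sup N
  obtain ⟨j, hj⟩ := hcon m
  obtain ⟨n, hmn, hn⟩ := hE.exists_mem_range_succ_notMem_range hj
  obtain ⟨k, hk, hwk⟩ := hw n ⟨j, hn⟩
  have hMk : M ≤ k := by
    by_contra! h
    exact hk (hE.range_mono ((Finset.le_sup (Finset.mem_range.2 h)).trans hmn) (hN k))
  have h₁ := hle n (hE.notMem_range_of_notMem_range (hwk ▸ hk))
  rw [hwk] at h₁
  exact (hM k hMk).not_ge h₁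

/-! ### Stabilization of the sequence -/

theorem isFrechetSpace_of_surjective (hE : IsStrictLFSpace i ι) {n : ℕ}
    (hn : Function.Surjective (ι n)) : IsFrechetSpace 𝕜 E := by
  let e : X n ≃ₗ[𝕜] E := LinearEquiv.ofBijective (ι n : X n →ₗ[𝕜] E) ⟨hE.injective n, hn⟩
  have := (hE.isFrechetSpace n).locallyConvex
  have := hE.locallyConvex
  have := (PolynormableSpace.withSeminorms 𝕜 E).topologicalAddGroup
  have he : Continuous e.symm := by
    refine (PolynormableSpace.withSeminorms 𝕜 (X n)).continuous_of_continuous_comp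
      (e.symm : E →ₗ[𝕜] X n) fun p => ?_
    -- The inverse is continuous because every continuous seminorm on `X n` extends to `E`.
    obtain ⟨q, hq, hqp, -⟩ := (hE.shift n).exists_seminorm_extension p.2 0
    refine hq.congr fun y => ?_
    obtain ⟨x, rfl⟩ := e.surjective y
    change q (ι n x) = p.1 (e.symm (e x))
    rw [e.symm_apply_apply]
    exact hqp x
  exact (hE.isFrechetSpace n).of_continuousLinearEquiv
    { e.symm with
      continuous_toFun := he
      continuous_invFun := (ι n).continuous }

theorem dense_compl_range (hE : IsStrictLFSpace i ι) {n : ℕ} (hn : ¬Function.Surjective (ι n)) :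
    Dense (Set.range (ι n))ᶜ := by
  have := hE.locallyConvex
  have hw := PolynormableSpace.withSeminorms 𝕜 E
  have := hw.topologicalAddGroup
  have := hw.continuousSMul
  rw [← interior_eq_empty_iff_dense_compl, ← Set.not_nonempty_iff_eq_empty]
  intro h
  refine hn (LinearMap.range_eq_top.1
    (Submodule.eq_top_of_nonempty_interior' (LinearMap.range (ι n : X n →ₗ[𝕜] E)) ?_))
  rwa [LinearMap.coe_range]

theorem exists_surjective (hE : IsStrictLFSpace i ι) (hκ : IsKappaFrechetUrysohn E) :
    ∃ n, Function.Surjective (ι n) := by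
  by_contra! hcon
  have := hE.locallyConvex
  have hw := PolynormableSpace.withSeminorms 𝕜 E
  have := hw.continuousSMul
  obtain ⟨y, hy⟩ := not_forall.1 (hcon 0)
  obtain ⟨p, hp, -, hpy⟩ := hE.exists_seminorm_eq_zero_one_le hy
  let V (k : ℕ) : Set E := {z | 1 / ((k : ℝ) + 1) < p z}
  have hV (k : ℕ) : IsOpen (V k) := isOpen_lt continuous_const hp
  let U : Set E := ⋃ k, V k ∩ (Set.range (ι k))ᶜ
  have hU : IsOpen U := isOpen_iUnion fun k => (hV k).inter (hE.isClosed_range k).isOpen_compl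
  have hVU (k : ℕ) : V k ⊆ closure U :=
    ((hE.dense_compl_range (hcon k)).open_subset_closure_inter (hV k)).trans
      (closure_mono (Set.subset_iUnion (fun k => V k ∩ (Set.range (ι k))ᶜ) k))
  have hpos {z : E} (hz : 0 < p z) : z ∈ closure U := by
    obtain ⟨k, hk⟩ := exists_nat_one_div_lt hz
    exact hVU k hk
  have h0 : (0 : E) ∈ closure U := by
    have hlim : Tendsto (fun a : 𝕜 => a • y) (𝓝[≠] 0) (𝓝 0) :=
      ((continuous_id.smul continuous_const).tendsto' (0 : 𝕜) (0 : E) (zero_smul 𝕜 y)).mono_left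
        nhdsWithin_le_nhds
    refine isClosed_closure.mem_of_tendsto hlim (eventually_mem_nhdsWithin.mono fun a ha => hpos ?_)
    rw [map_smul_eq_mul]
    exact mul_pos (norm_pos_iff.2 ha) (one_pos.trans_le hpy)
  obtain ⟨s, hsU, hs⟩ := hκ U hU 0 h0
  obtain ⟨m, hm⟩ := hE.exists_forall_mem_range_of_tendsto_zero hs
  have hlt : ∀ᶠ j in atTop, p (s j) < 1 / ((m : ℝ) + 1) :=
    ((hp.tendsto' 0 0 (map_zero p)).comp hs).eventually_lt_const (by positivity)
  obtain ⟨j, hj⟩ := hlt.exists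
  obtain ⟨k, hk, hk'⟩ := Set.mem_iUnion.1 (hsU j)
  -- `s j` avoids step `k` but lies in step `m`.
  have hkm : k ≤ m := by
    by_contra! h
    exact hk' (hE.range_mono h.le (hm j))
  have : 1 / ((m : ℝ) + 1) ≤ 1 / ((k : ℝ) + 1) := by gcongr
  exact lt_asymm hj (this.trans_lt hk)

end IsStrictLFSpace

theorem IsKappaFrechetUrysohn.of_frechetUrysohnSpace (X : Type*) [TopologicalSpace X]
    [FrechetUrysohnSpace X] : IsKappaFrechetUrysohn X :=
  fun _ _ _ hx => mem_closure_iff_seq_limit.1 hx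

theorem corollary2p7 {𝕜 E : Type*} [RCLike 𝕜] [AddCommGroup E] [Module 𝕜 E]
    [TopologicalSpace E] {X : ℕ → Type*} [∀ n, AddCommGroup (X n)] [∀ n, Module 𝕜 (X n)]
    [∀ n, TopologicalSpace (X n)]
    (i : ∀ n, X n →L[𝕜] X (n + 1)) (ι : ∀ n, X n →L[𝕜] E) (hE : IsStrictLFSpace i ι) :
    IsKappaFrechetUrysohn E ↔ IsFrechetSpace 𝕜 E := by
  refine ⟨fun hκ => ?_, fun hF => ?_⟩
  · obtain ⟨n, hn⟩ := hE.exists_surjective hκ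
    exact hE.isFrechetSpace_of_surjective hn
  · have := hF.firstCountableTopology
    exact .of_frechetUrysohnSpace E
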